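/- **Theorem.** Let $\mathbb{D}_1^\infty=\{\zeta=(\zeta_1,\zeta_2,\dots)\in\ell^1:\ |\zeta_j|<1\text{ for all }j\}$, a domain in the complex Banach space $\ell^1$. A function $F:\mathbb{D}_1^\infty\to\mathbb{C}$ is called analytic if it is locally bounded and, for all $\zeta\in\mathbb{D}_1^\infty$ and $\eta\in\ell^1$, the function $z\mapsto F(\zeta+z\eta)$ is analytic on $\{z\in\mathbb{C}:\zeta+z\eta\in\mathbb{D}_1^\infty\}$. For $1\le p<\infty$ let $\mathbf{H}^p_\infty$ be the space of all analytic functions $F$ on $\mathbb{D}_1^\infty$ with $$\|F\|_p^p=\sup_{0<r<1}\int_{\mathbb{T}^\infty}|F(rw_1,r^2w_2,\dots,r^nw_n,\dots)|^p\,\mathrm{d}m_\infty(w)<\infty,$$ where $m_\infty$ is the Haar probability measure of the infinite torus $\mathbb{T}^\infty=\mathbb{T}\times\mathbb{T}\times\cdots$. For $n\in\mathbb{N}=\{1,2,\dots\}$ with prime factorization $n=p_1^{\alpha_1}\cdots p_k^{\alpha_k}$, where $p_j$ is the $j$-th prime number, write $\zeta^{\alpha(n)}=\zeta_1^{\alpha_1}\cdots\zeta_k^{\alpha_k}$.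 Regard $\mathbf{H}^p_\infty$ as a space of complex sequences, by identifying $F$ with the sequence $\{a_n\}_{n=1}^\infty$ of coefficients of its monomial expansion $F(\zeta)=\sum_{n=1}^\infty a_n\zeta^{\alpha(n)}$, which converges absolutely at every $\zeta\in\mathbb{D}_1^\infty$. Let $(\mathbf{H}^2_\infty,\mathbf{H}^p_\infty)$ be the space of coefficient multipliers of $\mathbf{H}^2_\infty$ into $\mathbf{H}^p_\infty$, that is, of all complex sequences $\{\lambda_n\}_{n=1}^\infty$ such that $\{\lambda_na_n\}_{n=1}^\infty\in\mathbf{H}^p_\infty$ whenever $\{a_n\}_{n=1}^\infty\in\mathbf{H}^2_\infty$. If $1\le p\le 2$, then $$(\mathbf{H}^2_\infty,\mathbf{H}^p_\infty)=\ell^\infty,$$ where $\ell^\infty$ denotes the space of all bounded complex sequences. -/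

import Mathlib

open MeasureTheory Set
open scoped ENNReal Topology

noncomputable section

namespace InfHardy

/-- The complex Banach space `ℓ¹`; the variable `ζ_{j+1}` is the coordinate `ζ j`. -/
abbrev Ell1 : Type := lp (fun _ : ℕ => ℂ) 1

/-- The domain `𝔻₁^∞ = 𝔻^∞ ∩ ℓ¹`. -/
def polydisk : Set Ell1 := {ζ | ∀ j, ‖ζ j‖ < 1}

/-- `F` is analytic on `𝔻₁^∞`: it is locally bounded, and `z ↦ F (ζ + z η)` is holomorphic on
the (open) set of those `z` with `ζ + z η ∈ 𝔻₁^∞`, for all `ζ ∈ 𝔻₁^∞` and `η ∈ ℓ¹`. -/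
structure IsAnalytic (F : Ell1 → ℂ) : Prop where
  locallyBounded : ∀ ζ ∈ polydisk, ∃ C : ℝ, ∀ᶠ ξ in 𝓝[polydisk] ζ, ‖F ξ‖ ≤ C
  holomorphic_lines : ∀ ζ ∈ polydisk, ∀ η : Ell1,
    DifferentiableOn ℂ (fun z : ℂ => F (ζ + z • η)) {z : ℂ | ζ + z • η ∈ polydisk}

/-- The infinite torus `𝕋^∞`, in angular coordinates: `θ` stands for the point with coordinates
`w_j = exp (2πi θ_j)`, where `θ_j ∈ ℝ / ℤ`. -/
abbrev Torus : Type := ℕ → UnitAddCircle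

/-- The Haar probability measure of the infinite torus: the product of the normalized Haar (arc
length) measures of the circles. -/
def torusMeasure : Measure Torus :=
  Measure.infinitePi fun _ : ℕ => (AddCircle.haarAddCircle : Measure UnitAddCircle)

/-- The coordinates of a dilated torus point are summable. -/
theorem memℓp_dilate (r : Ioo (0 : ℝ) 1) (θ : Torus) :
    Memℓp (fun j : ℕ => ((r : ℝ) : ℂ) ^ (j + 1) * (AddCircle.toCircle (θ j) : ℂ)) 1 := by
  apply memℓp_gen
  have hs : Summable fun j : ℕ => (r : ℝ) ^ (j + 1) :=
    (summable_nat_add_iff 1).2 (summable_geometric_of_lt_one r.2.1.le r.2.2)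
  simpa [abs_of_pos r.2.1, Circle.norm_coe] using hs

/-- The point `(r w₁, r² w₂, …, rⁿ wₙ, …)` of `ℓ¹`, for `0 < r < 1` and `w ∈ 𝕋^∞`. -/
def dilate (r : Ioo (0 : ℝ) 1) (θ : Torus) : Ell1 := ⟨_, memℓp_dilate r θ⟩

/-- The quantity `‖F‖_p^p = sup_{0<r<1} ∫ |F(r w₁, r² w₂, …)|^p dm_∞(w)`, in `[0, ∞]`. -/
def hardyIntegral (p : ℝ) (F : Ell1 → ℂ) : ℝ≥0∞ :=
  ⨆ r : Ioo (0 : ℝ) 1, ∫⁻ θ, ‖F (dilate r θ)‖ₑ ^ p ∂torusMeasure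

/-- `F` belongs to the Hardy space over `𝔻₁^∞` with exponent `p`. -/
def IsHardy (p : ℝ) (F : Ell1 → ℂ) : Prop :=
  IsAnalytic F ∧ hardyIntegral p F < ∞

/-- The exponent sequence `α(n)` of the prime factorization of `n`: the exponent of the `j`-th prime
number (counted from `j = 0`) is `α(n)_j`. -/
def alpha (n : ℕ+) : ℕ →₀ ℕ :=
  (n : ℕ).factorization.comapDomain (Nat.nth Nat.Prime)
    (Nat.nth_injective Nat.infinite_setOfPred_prime).injOn

/-- The monomial `ζ^{α(n)}`. -/
def monomial (n : ℕ+) (ζ : Ell1) : ℂ := (alpha n).prod fun j k => ζ j ^ k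

/-- `F(ζ) = ∑ₙ aₙ ζ^{α(n)}` on `𝔻₁^∞`, the series being unconditionally (that is, absolutely)
convergent at every point. -/
def HasMonomialExpansion (F : Ell1 → ℂ) (a : ℕ+ → ℂ) : Prop :=
  ∀ ζ ∈ polydisk, HasSum (fun n : ℕ+ => a n * monomial n ζ) (F ζ)

/-- The Hardy space `𝐇^p_∞`, regarded as a space of complex sequences: the sequences of coefficients
of the monomial expansions of its members. -/
def hardySeq (p : ℝ) : Set (ℕ+ → ℂ) :=
  {a | ∃ F : Ell1 → ℂ, IsHardy p F ∧ HasMonomialExpansion F a}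

/-- The coefficient multipliers of a sequence space `X` into a sequence space `Y`. -/
def multipliers (X Y : Set (ℕ+ → ℂ)) : Set (ℕ+ → ℂ) :=
  {l | ∀ x ∈ X, (fun n => l n * x n) ∈ Y}

/-- The space `ℓ^∞` of bounded complex sequences. -/
def ellInfty : Set (ℕ+ → ℂ) := {l | ∃ C : ℝ, ∀ n, ‖l n‖ ≤ C}

end InfHardy

end

noncomputable section

namespace InfHardy

open scoped ComplexConjugate

/-! As sequence spaces, `hardySeq 2` is exactly ℓ². Parseval on the torus, applied to dilates with r
→ 1, gives one inclusion (`summable_sq_of_mem_hardySeq_two`). Conversely, a square-summable sequence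
defines an analytic function, because ∑ |ζ^α(n)| converges on the polydisk by an Euler product
(`IsSubunit.sum_realMonomial_le`). For p ≤ 2 its Hardy integral is finite, since L² norms dominate
L^p norms on a probability space (`mem_hardySeq_of_summable_sq`). Bounded sequences preserve ℓ²,
hence multiply `hardySeq 2` into `hardySeq p`.

Conversely, for p ≥ 1 every sequence in `hardySeq p` is bounded, being made of Fourier coefficients
(`exists_norm_le_of_mem_hardySeq`). If λ were unbounded, with |λ| ≥ 4^k at distinct indices ν k, the
ℓ² sequence equal to 2^(-k) at ν k and zero elsewhere would have an unbounded product with λ. -/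

/-! ### Summability of the monomials on the polydisk. -/

theorem alpha_injective : Function.Injective alpha := by
  intro m n h
  apply PNat.coe_injective
  refine Nat.eq_of_factorization_eq m.ne_zero n.ne_zero fun q => ?_
  by_cases hq : q.Prime
  · have := DFunLike.congr_fun h (Nat.count Nat.Prime q)
    simpa [alpha, Nat.nth_count hq] using this
  · simp [Nat.factorization_eq_zero_of_not_prime _ hq]

/-- The value of the `n`-th monomial at a sequence of real numbers. -/
def realMonomial (x : ℕ → ℝ) (n : ℕ+) : ℝ := (alpha n).prod fun j k => x j ^ k

theorem realMonomial_nonneg {x : ℕ → ℝ} (hx : ∀ j, 0 ≤ x j) (n : ℕ+) : 0 ≤ realMonomial x n :=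
  Finset.prod_nonneg fun j _ => pow_nonneg (hx j) _

theorem realMonomial_le_one {x : ℕ → ℝ} (hx : ∀ j, 0 ≤ x j) (hx1 : ∀ j, x j ≤ 1) (n : ℕ+) :
    realMonomial x n ≤ 1 :=
  Finset.prod_le_one (fun j _ => pow_nonneg (hx j) _) fun j _ => pow_le_one₀ (hx j) (hx1 j)

theorem realMonomial_mono {x y : ℕ → ℝ} (hx : ∀ j, 0 ≤ x j) (hxy : ∀ j, x j ≤ y j) (n : ℕ+) :
    realMonomial x n ≤ realMonomial y n :=
  Finset.prod_le_prod (fun j _ => pow_nonneg (hx j) _)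
    fun j _ => pow_le_pow_left₀ (hx j) (hxy j) _

theorem norm_monomial (n : ℕ+) (ζ : Ell1) : ‖monomial n ζ‖ = realMonomial (fun j => ‖ζ j‖) n := by
  simp [monomial, realMonomial, Finsupp.prod, norm_prod]

/-- A sequence of nonnegative numbers, bounded by `ρ < 1`, with sum at most `S`. -/
structure IsSubunit (x : ℕ → ℝ) (ρ S : ℝ) : Prop where
  nonneg : ∀ j, 0 ≤ x j
  le : ∀ j, x j ≤ ρ
  lt_one : ρ < 1
  sum_le : ∀ s : Finset ℕ, ∑ j ∈ s, x j ≤ S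

theorem geom_partial_le_exp {x ρ : ℝ} (hx : 0 ≤ x) (hxρ : x ≤ ρ) (hρ : ρ < 1) (K : ℕ) :
    ∑ k ∈ Finset.range K, x ^ k ≤ Real.exp (x / (1 - ρ)) := by
  have h1 : x < 1 := hxρ.trans_lt hρ
  have h2 : 0 < 1 - x := by linarith
  calc ∑ k ∈ Finset.range K, x ^ k ≤ (1 - x)⁻¹ := by
        rw [← tsum_geometric_of_lt_one hx h1]
        exact (summable_geometric_of_lt_one hx h1).sum_le_tsum _ fun i _ => pow_nonneg hx i
    _ = x / (1 - x) + 1 := by field_simp; simp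
    _ ≤ x / (1 - ρ) + 1 := by
        gcongr
    _ ≤ _ := Real.add_one_le_exp _

/-- Euler product: since `alpha` is injective, the sum is part of the expansion of a finite product
of truncated geometric series, and each factor is at most exp(x_j / (1 - ρ)). -/
theorem IsSubunit.sum_realMonomial_le {x : ℕ → ℝ} {ρ S : ℝ} (h : IsSubunit x ρ S)
    (T : Finset ℕ+) : ∑ n ∈ T, realMonomial x n ≤ Real.exp (S / (1 - ρ)) := by
  classical
  have hρ : 0 < 1 - ρ := sub_pos.2 h.lt_one
  let U : Finset ℕ := T.biUnion fun n => (alpha n).support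
  -- The `+ 1` makes `Finset.range K` contain the largest exponent occurring in `T`.
  let K : ℕ := (T.sup fun n => (alpha n).support.sup (alpha n)) + 1
  have hval : ∀ n ∈ T, realMonomial x n = ∏ j : U, x j ^ (alpha n j) := by
    intro n hn
    rw [Finset.prod_coe_sort U fun j => x j ^ alpha n j, realMonomial]
    exact Finsupp.prod_of_support_subset _
      (Finset.subset_biUnion_of_mem (fun n => (alpha n).support) hn) _ (by simp)
  have hmem : ∀ n ∈ T, (fun j : U => alpha n j) ∈
      Fintype.piFinset fun _ : U => Finset.range K := by
    intro n hn
    simp only [Fintype.mem_piFinset, Finset.mem_range, K, Nat.lt_succ_iff]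
    intro j
    by_cases hj : (j : ℕ) ∈ (alpha n).support
    · exact (Finset.le_sup (f := alpha n) hj).trans
        (Finset.le_sup (f := fun n => (alpha n).support.sup (alpha n)) hn)
    · simp [Finsupp.notMem_support_iff.1 hj]
  have hinj : Set.InjOn (fun (n : ℕ+) (j : U) => alpha n j) T := by
    intro m hm n hn hmn
    apply alpha_injective
    ext j
    by_cases hj : j ∈ U
    · exact congrFun hmn ⟨j, hj⟩
    · have h1 : j ∉ (alpha m).support := fun h => hj (Finset.mem_biUnion.2 ⟨m, hm, h⟩)
      have h2 : j ∉ (alpha n).support := fun h => hj (Finset.mem_biUnion.2 ⟨n, hn, h⟩)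
      rw [Finsupp.notMem_support_iff.1 h1, Finsupp.notMem_support_iff.1 h2]
  calc ∑ n ∈ T, realMonomial x n
      = ∑ n ∈ T, ∏ j : U, x j ^ (alpha n j) := Finset.sum_congr rfl hval
    _ = ∑ k ∈ T.image fun n (j : U) => alpha n j, ∏ j : U, x j ^ k j :=
        (Finset.sum_image hinj (f := fun k : U → ℕ => ∏ j : U, x j ^ k j)).symm
    _ ≤ ∑ k ∈ Fintype.piFinset fun _ : U => Finset.range K, ∏ j : U, x j ^ k j :=
        Finset.sum_le_sum_of_subset_of_nonneg (Finset.image_subset_iff.2 hmem)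
          fun k _ _ => Finset.prod_nonneg fun j _ => pow_nonneg (h.nonneg j) _
    _ = ∏ j : U, ∑ k ∈ Finset.range K, x j ^ k := (Finset.prod_univ_sum _ _).symm
    _ ≤ ∏ j : U, Real.exp (x j / (1 - ρ)) :=
        Finset.prod_le_prod
          (fun j _ => Finset.sum_nonneg fun k _ => pow_nonneg (h.nonneg j) k)
          fun j _ => geom_partial_le_exp (h.nonneg j) (h.le j) h.lt_one K
    _ = Real.exp ((∑ j ∈ U, x j) / (1 - ρ)) := by
        rw [← Real.exp_sum, ← Finset.sum_div, Finset.sum_coe_sort U x]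
    _ ≤ _ := by
        gcongr
        exact h.sum_le U

theorem IsSubunit.summable_mul {x : ℕ → ℝ} {ρ S : ℝ} (h : IsSubunit x ρ S) {a : ℕ+ → ℂ}
    (ha : Summable fun n => ‖a n‖ ^ 2) :
    (Summable fun n => ‖a n‖ * realMonomial x n) ∧
      ∑' n, ‖a n‖ * realMonomial x n ≤ (∑' n, ‖a n‖ ^ 2) + Real.exp (S / (1 - ρ)) := by
  have h0 := realMonomial_nonneg h.nonneg
  have h1 := realMonomial_le_one h.nonneg fun j => (h.le j).trans h.lt_one.le
  have hX : Summable (realMonomial x) := summable_of_sum_le h0 h.sum_realMonomial_le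
  -- With 0 ≤ x ≤ 1, the square x² arising from the AM-GM inequality is at most x.
  have hle : ∀ n, ‖a n‖ * realMonomial x n ≤ ‖a n‖ ^ 2 + realMonomial x n := fun n => by
    nlinarith [sq_nonneg (‖a n‖ - realMonomial x n), h0 n, h1 n, sq_nonneg ‖a n‖,
      mul_nonneg (h0 n) (sub_nonneg.2 (h1 n))]
  have hs := Summable.of_nonneg_of_le (fun n => mul_nonneg (norm_nonneg _) (h0 n)) hle (ha.add hX)
  refine ⟨hs, (hs.tsum_le_tsum hle (ha.add hX)).trans ?_⟩
  rw [ha.tsum_add hX]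
  gcongr
  exact hX.tsum_le_of_sum_le h.sum_realMonomial_le

theorem hasSum_norm_ell1 (ζ : Ell1) : HasSum (fun j => ‖ζ j‖) ‖ζ‖ := by
  simpa using lp.hasSum_norm (p := 1) (by simp) ζ

theorem sum_norm_le (ζ : Ell1) (s : Finset ℕ) : ∑ j ∈ s, ‖ζ j‖ ≤ ‖ζ‖ :=
  sum_le_hasSum s (fun _ _ => norm_nonneg _) (hasSum_norm_ell1 ζ)

/-- Coordinates of an ℓ¹ point tend to zero, so only finitely many reach 1/2, and these have a
largest modulus. -/
theorem exists_bound_of_mem_polydisk {ζ : Ell1} (hζ : ζ ∈ polydisk) :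
    ∃ ρ < 1, ∀ j, ‖ζ j‖ ≤ ρ := by
  have h0 := (hasSum_norm_ell1 ζ).summable.tendsto_cofinite_zero
  have hfin : {j | ¬ ‖ζ j‖ < 1 / 2}.Finite :=
    h0.eventually (gt_mem_nhds (by norm_num : (0 : ℝ) < 1 / 2))
  rcases Set.eq_empty_or_nonempty {j | ¬ ‖ζ j‖ < 1 / 2} with he | hne
  · refine ⟨1 / 2, by norm_num, fun j => ?_⟩
    by_contra hj
    have : j ∈ {j | ¬ ‖ζ j‖ < 1 / 2} := fun h => hj h.le
    rw [he] at this
    exact this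
  · obtain ⟨i, hi, hmax⟩ := hfin.exists_maximalFor (fun j => ‖ζ j‖) _ hne
    refine ⟨‖ζ i‖, hζ i, fun j => ?_⟩
    by_cases hj : ‖ζ j‖ < 1 / 2
    · exact hj.le.trans (not_lt.1 hi)
    · exact le_of_not_gt fun hlt => (hmax hj hlt.le).not_gt hlt

/-- A common coordinatewise majorant for all points ζ + wη with |w| ≤ δ, as needed for the
Weierstrass M-test. -/
theorem isSubunit_norm_add {ζ : Ell1} (η : Ell1) {ρ δ : ℝ} (hρ : ∀ j, ‖ζ j‖ ≤ ρ) (hδ : 0 ≤ δ)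
    (h : ρ + δ * ‖η‖ < 1) :
    IsSubunit (fun j => ‖ζ j‖ + δ * ‖η j‖) (ρ + δ * ‖η‖) (‖ζ‖ + δ * ‖η‖) where
  nonneg _ := by positivity
  le j := by
    gcongr
    · exact hρ j
    · exact lp.norm_apply_le_norm one_ne_zero η j
  lt_one := h
  sum_le s := by
    rw [Finset.sum_add_distrib, ← Finset.mul_sum]
    gcongr <;> exact sum_norm_le _ s

/-! ### Square-summable coefficients define analytic functions. -/

/-- The sum of the monomial series with coefficients `a`. -/
def seriesSum (a : ℕ+ → ℂ) (ζ : Ell1) : ℂ := ∑' n, a n * monomial n ζ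

theorem summable_norm_term {a : ℕ+ → ℂ} (ha : Summable fun n => ‖a n‖ ^ 2) {ζ : Ell1} {ρ : ℝ}
    (hρ : ρ < 1) (hζ : ∀ j, ‖ζ j‖ ≤ ρ) :
    (Summable fun n => ‖a n * monomial n ζ‖) ∧
      ∑' n, ‖a n * monomial n ζ‖ ≤ (∑' n, ‖a n‖ ^ 2) + Real.exp (‖ζ‖ / (1 - ρ)) := by
  simp only [norm_mul, norm_monomial]
  exact IsSubunit.summable_mul ⟨fun _ => norm_nonneg _, hζ, hρ, sum_norm_le ζ⟩ ha

theorem hasMonomialExpansion_seriesSum {a : ℕ+ → ℂ} (ha : Summable fun n => ‖a n‖ ^ 2) :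
    HasMonomialExpansion (seriesSum a) a := by
  intro ζ hζ
  obtain ⟨ρ, hρ, hζρ⟩ := exists_bound_of_mem_polydisk hζ
  exact (summable_norm_term ha hρ hζρ).1.of_norm.hasSum

theorem differentiable_monomial_line (n : ℕ+) (ζ η : Ell1) :
    Differentiable ℂ fun z : ℂ => monomial n (ζ + z • η) := by
  simp only [monomial, Finsupp.prod, lp.coeFn_add, lp.coeFn_smul, Pi.add_apply, Pi.smul_apply,
    smul_eq_mul]
  fun_prop

theorem isAnalytic_seriesSum {a : ℕ+ → ℂ} (ha : Summable fun n => ‖a n‖ ^ 2) :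
    IsAnalytic (seriesSum a) where
  locallyBounded ζ hζ := by
    obtain ⟨ρ, hρ, hζρ⟩ := exists_bound_of_mem_polydisk hζ
    have hε : 0 < (1 - ρ) / 2 := by linarith
    refine ⟨(∑' n, ‖a n‖ ^ 2) + Real.exp ((‖ζ‖ + (1 - ρ) / 2) / (1 - (1 + ρ) / 2)),
      nhdsWithin_le_nhds ?_⟩
    filter_upwards [Metric.ball_mem_nhds ζ hε] with ξ hξ
    rw [mem_ball_iff_norm] at hξ
    have hj : ∀ j, ‖ξ j‖ ≤ (1 + ρ) / 2 := fun j => by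
      have h1 : ‖ξ j - ζ j‖ ≤ ‖ξ - ζ‖ := lp.norm_apply_le_norm one_ne_zero (ξ - ζ) j
      have h2 := norm_le_norm_add_norm_sub' (ξ j) (ζ j)
      linarith [hζρ j]
    have hn : ‖ξ‖ ≤ ‖ζ‖ + (1 - ρ) / 2 := by
      have h2 := norm_le_norm_add_norm_sub' ξ ζ
      linarith
    obtain ⟨hs, hle⟩ := summable_norm_term ha (by linarith) hj
    refine (norm_tsum_le_tsum_norm hs).trans (hle.trans ?_)
    gcongr
    linarith
  holomorphic_lines ζ hζ η := by
    intro z hz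
    obtain ⟨ρ, hρ, hζρ⟩ := exists_bound_of_mem_polydisk hz
    have hη : 0 < ‖η‖ + 1 := by positivity
    -- Chosen so that δ‖η‖ stays below 1 - ρ; the `+ 1` covers η = 0.
    set δ : ℝ := (1 - ρ) / 2 / (‖η‖ + 1) with hδdef
    have hδ : 0 < δ := by
      have : 0 < (1 - ρ) / 2 := by linarith
      positivity
    have hlt : ρ + δ * ‖η‖ < 1 := by
      have : δ * (‖η‖ + 1) = (1 - ρ) / 2 := by rw [hδdef]; field_simp
      nlinarith
    have hsub := isSubunit_norm_add η hζρ hδ.le hlt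
    have hd : DifferentiableOn ℂ (fun w : ℂ => ∑' n, a n * monomial n (ζ + w • η))
        (Metric.ball z δ) := by
      refine Complex.differentiableOn_tsum_of_summable_norm (hsub.summable_mul ha).1
        (fun n => ((differentiable_monomial_line n ζ η).const_mul _).differentiableOn)
        Metric.isOpen_ball fun n w hw => ?_
      rw [norm_mul, norm_monomial]
      gcongr
      refine realMonomial_mono (fun _ => norm_nonneg _) (fun j => ?_) n
      rw [mem_ball_iff_norm] at hw
      have : (ζ + w • η) j = (ζ + z • η) j + (w - z) * η j := by
        simp only [lp.coeFn_add, lp.coeFn_smul, Pi.add_apply, Pi.smul_apply, smul_eq_mul]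
        ring
      rw [this]
      refine (norm_add_le _ _).trans ?_
      rw [norm_mul]
      gcongr
    exact (hd.differentiableAt (Metric.ball_mem_nhds z hδ)).differentiableWithinAt

/-! ### Fourier analysis on the infinite torus. -/

instance : IsProbabilityMeasure torusMeasure := by unfold torusMeasure; infer_instance

/-- The `n`-th monomial, restricted to the torus. -/
def character (n : ℕ+) (θ : Torus) : ℂ :=
  (alpha n).prod fun j k => (AddCircle.toCircle (θ j) : ℂ) ^ k

theorem continuous_character (n : ℕ+) : Continuous (character n) :=
  continuous_finsetProd _ fun j _ =>
    (continuous_subtype_val.comp (AddCircle.continuous_toCircle.comp (continuous_apply j))).pow _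

theorem norm_character (n : ℕ+) (θ : Torus) : ‖character n θ‖ = 1 := by
  simp [character, Finsupp.prod, norm_prod, Circle.norm_coe]

theorem monomial_dilate (n : ℕ+) (r : Ioo (0 : ℝ) 1) (θ : Torus) :
    monomial n (dilate r θ) =
      (realMonomial (fun j => (r : ℝ) ^ (j + 1)) n : ℂ) * character n θ := by
  simp only [monomial, realMonomial, character, dilate, Finsupp.prod, Complex.ofReal_prod,
    Complex.ofReal_pow, ← Finset.prod_mul_distrib, ← mul_pow]

theorem integral_fourier (k : ℤ) :
    ∫ x : UnitAddCircle, fourier k x ∂AddCircle.haarAddCircle = if k = 0 then 1 else 0 := by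
  have h := congrFun (fourierCoeff_fourier (T := (1 : ℝ)) k) 0
  simp only [fourierCoeff, neg_zero, fourier_zero, one_smul] at h
  rw [h, Pi.single_apply]
  simp only [eq_comm]

theorem integral_prod_fourier (s : Finset ℕ) (k : ℕ → ℤ) :
    ∫ θ : Torus, ∏ j ∈ s, (fourier (k j) (θ j) : ℂ) ∂torusMeasure =
      if ∀ j ∈ s, k j = 0 then 1 else 0 := by
  have h := integral_restrict_infinitePi
    (μ := fun _ : ℕ => (AddCircle.haarAddCircle : Measure UnitAddCircle)) (s := s)
    (f := fun y => ∏ j : s, (fourier (k j) (y j) : ℂ))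
    (Continuous.aestronglyMeasurable (by fun_prop))
  rw [integral_fintype_prod_eq_prod
    (f := fun (j : s) (x : UnitAddCircle) => (fourier (k j) x : ℂ))] at h
  simp only [integral_fourier, Finset.restrict] at h
  rw [torusMeasure]
  simp_rw [← Finset.prod_coe_sort s]
  rw [h]
  rw [Finset.prod_ite_zero]
  simp

theorem character_mul_conj (m n : ℕ+) (θ : Torus) :
    character m θ * conj (character n θ) =
      ∏ j ∈ (alpha m).support ∪ (alpha n).support,
        (fourier ((alpha m j : ℤ) - alpha n j) (θ j) : ℂ) := by
  rw [character, character,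
    Finsupp.prod_of_support_subset (alpha m) Finset.subset_union_left _ (by simp),
    Finsupp.prod_of_support_subset (alpha n) Finset.subset_union_right _ (by simp),
    map_prod, ← Finset.prod_mul_distrib]
  refine Finset.prod_congr rfl fun j _ => ?_
  rw [sub_eq_add_neg, fourier_add, fourier_neg]
  simp [fourier_apply, AddCircle.toCircle_nsmul]

theorem integral_character_mul_conj (m n : ℕ+) :
    ∫ θ, character m θ * conj (character n θ) ∂torusMeasure = if m = n then 1 else 0 := by
  simp_rw [character_mul_conj]
  rw [integral_prod_fourier _ fun j => (alpha m j : ℤ) - alpha n j]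
  congr 1
  refine propext ⟨fun h => alpha_injective (Finsupp.ext fun j => ?_), fun h j _ => by simp [h]⟩
  by_cases hj : j ∈ (alpha m).support ∪ (alpha n).support
  · have := h j hj
    omega
  · simp only [Finset.mem_union, Finsupp.mem_support_iff, not_or, not_not] at hj
    rw [hj.1, hj.2]

/-- The sum of an absolutely convergent Fourier series on the torus. -/
def fourierSum (c : ℕ+ → ℂ) (θ : Torus) : ℂ := ∑' n, c n * character n θ

theorem norm_coeff_mul_character (c : ℕ+ → ℂ) (n : ℕ+) (θ : Torus) :
    ‖c n * character n θ‖ = ‖c n‖ := by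
  rw [norm_mul, norm_character, mul_one]

theorem continuous_fourierSum {c : ℕ+ → ℂ} (hc : Summable fun n => ‖c n‖) :
    Continuous (fourierSum c) :=
  continuous_tsum (fun n => (continuous_character n).const_mul _) hc
    fun n θ => (norm_coeff_mul_character c n θ).le

theorem integrable_of_continuous {g : Torus → ℂ} (hg : Continuous g) :
    Integrable g torusMeasure := by
  obtain ⟨C, hC⟩ := isCompact_univ.exists_bound_of_continuousOn hg.continuousOn
  exact Integrable.of_bound hg.aestronglyMeasurable C (ae_of_all _ fun θ => hC θ (mem_univ θ))

theorem hasSum_integral_fourierSum_mul {c : ℕ+ → ℂ} (hc : Summable fun n => ‖c n‖)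
    {g : Torus → ℂ} (hg : Continuous g) :
    HasSum (fun n => c n * ∫ θ, character n θ * g θ ∂torusMeasure)
      (∫ θ, fourierSum c θ * g θ ∂torusMeasure) := by
  have h := hasSum_integral_of_summable_integral_norm (μ := torusMeasure)
    (F := fun n θ => c n * character n θ * g θ)
    (fun n => integrable_of_continuous (((continuous_character n).const_mul _).mul hg)) ?_
  · simp only [tsum_mul_right] at h
    simpa only [fourierSum, mul_assoc, integral_const_mul] using h
  · simp only [norm_mul _ (g _), norm_coeff_mul_character, integral_const_mul]
    exact hc.mul_right _

theorem integral_fourierSum_mul_conj_character {c : ℕ+ → ℂ} (hc : Summable fun n => ‖c n‖)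
    (m : ℕ+) : ∫ θ, fourierSum c θ * conj (character m θ) ∂torusMeasure = c m := by
  have h := hasSum_integral_fourierSum_mul hc
    (Complex.continuous_conj.comp (continuous_character m))
  simp only [Function.comp_apply, integral_character_mul_conj, mul_ite, mul_one, mul_zero] at h
  exact h.unique (hasSum_ite_eq m (c m) |> fun h' => by
    convert h' using 2 with n
    split_ifs with hn <;> simp [hn])

/-- Parseval: integrate the series termwise against the conjugate of its own sum. -/
theorem hasSum_sq_coeff {c : ℕ+ → ℂ} (hc : Summable fun n => ‖c n‖) :
    HasSum (fun n => ‖c n‖ ^ 2) (∫ θ, ‖fourierSum c θ‖ ^ 2 ∂torusMeasure) := by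
  have h := hasSum_integral_fourierSum_mul hc
    (Complex.continuous_conj.comp (continuous_fourierSum hc))
  have hn : ∀ n, ∫ θ, character n θ * conj (fourierSum c θ) ∂torusMeasure = conj (c n) := by
    intro n
    rw [← integral_fourierSum_mul_conj_character hc n, ← integral_conj]
    simp [mul_comm]
  simp only [Function.comp_apply, hn, Complex.mul_conj'] at h
  have h2 : ∫ θ, ((‖fourierSum c θ‖ : ℂ)) ^ 2 ∂torusMeasure =
      ((∫ θ, ‖fourierSum c θ‖ ^ 2 ∂torusMeasure : ℝ) : ℂ) := by
    rw [← integral_complex_ofReal]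
    simp
  rw [h2] at h
  exact_mod_cast h

theorem lintegral_sq_fourierSum {c : ℕ+ → ℂ} (hc : Summable fun n => ‖c n‖) :
    ∫⁻ θ, ‖fourierSum c θ‖ₑ ^ (2 : ℝ) ∂torusMeasure = ENNReal.ofReal (∑' n, ‖c n‖ ^ 2) := by
  have hcont := continuous_fourierSum hc
  have hi : Integrable (fun θ => ‖fourierSum c θ‖ ^ 2) torusMeasure := by
    simpa only [Pi.pow_apply, norm_pow] using (integrable_of_continuous (hcont.pow 2)).norm
  rw [(hasSum_sq_coeff hc).tsum_eq, ofReal_integral_eq_lintegral_ofReal hi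
    (ae_of_all _ fun θ => sq_nonneg _)]
  refine lintegral_congr fun θ => ?_
  rw [← ofReal_norm, ENNReal.ofReal_rpow_of_nonneg (norm_nonneg _) zero_le_two, Real.rpow_two]

/-- The coefficient is an integral against a unimodular character, so the L¹ norm bounds it, and the
L^p norm bounds the L¹ norm. -/
theorem enorm_coeff_rpow_le {c : ℕ+ → ℂ} (hc : Summable fun n => ‖c n‖) {p : ℝ} (hp : 1 ≤ p)
    (n : ℕ+) : ‖c n‖ₑ ^ p ≤ ∫⁻ θ, ‖fourierSum c θ‖ₑ ^ p ∂torusMeasure := by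
  have hp0 : 0 < p := zero_lt_one.trans_le hp
  rw [lintegral_rpow_enorm_eq_rpow_eLpNorm' hp0]
  gcongr
  refine le_trans ?_ (eLpNorm'_le_eLpNorm'_of_exponent_le one_pos hp _
    (continuous_fourierSum hc).aestronglyMeasurable)
  rw [← integral_fourierSum_mul_conj_character hc n]
  refine (enorm_integral_le_lintegral_enorm _).trans (le_of_eq ?_)
  simp only [eLpNorm'_eq_lintegral_enorm, ENNReal.rpow_one, div_one, enorm_mul]
  refine lintegral_congr fun θ => ?_
  rw [← ofReal_norm (conj (character n θ)), RCLike.norm_conj, norm_character]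
  simp

/-! ### Dilations, and the comparison of Hardy spaces with ℓ² and ℓ^∞. -/

/-- The factor by which the `n`-th monomial shrinks under the dilation with parameter `r`. -/
def dilationFactor (r : ℝ) (n : ℕ+) : ℝ := realMonomial (fun j => r ^ (j + 1)) n

theorem continuous_dilationFactor (n : ℕ+) : Continuous fun r => dilationFactor r n := by
  unfold dilationFactor realMonomial Finsupp.prod
  fun_prop

theorem dilationFactor_one (n : ℕ+) : dilationFactor 1 n = 1 := by
  simp [dilationFactor, realMonomial]

theorem dilationFactor_nonneg (r : Ioo (0 : ℝ) 1) (n : ℕ+) : 0 ≤ dilationFactor r n :=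
  realMonomial_nonneg (fun _ => pow_nonneg r.2.1.le _) n

theorem dilationFactor_le_one (r : Ioo (0 : ℝ) 1) (n : ℕ+) : dilationFactor r n ≤ 1 :=
  realMonomial_le_one (fun _ => pow_nonneg r.2.1.le _) (fun _ => pow_le_one₀ r.2.1.le r.2.2.le) n

theorem dilate_mem_polydisk (r : Ioo (0 : ℝ) 1) (θ : Torus) : dilate r θ ∈ polydisk := by
  intro j
  simpa [dilate, Circle.norm_coe, abs_of_pos r.2.1] using
    pow_lt_one₀ r.2.1.le r.2.2 (Nat.succ_ne_zero j)

theorem HasMonomialExpansion.hasSum_dilate {F : Ell1 → ℂ} {a : ℕ+ → ℂ}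
    (h : HasMonomialExpansion F a) (r : Ioo (0 : ℝ) 1) (θ : Torus) :
    HasSum (fun n => a n * dilationFactor r n * character n θ) (F (dilate r θ)) := by
  simpa only [monomial_dilate, ← mul_assoc, dilationFactor] using h _ (dilate_mem_polydisk r θ)

theorem HasMonomialExpansion.summable_dilate {F : Ell1 → ℂ} {a : ℕ+ → ℂ}
    (h : HasMonomialExpansion F a) (r : Ioo (0 : ℝ) 1) :
    Summable fun n => ‖a n * dilationFactor r n‖ := by
  -- Characters are unimodular, so convergence at the single torus point w = (1, 1, …) suffices.
  simpa only [norm_coeff_mul_character fun n => a n * dilationFactor r n] using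
    (h.hasSum_dilate r 0).summable.norm

theorem HasMonomialExpansion.dilate_eq {F : Ell1 → ℂ} {a : ℕ+ → ℂ}
    (h : HasMonomialExpansion F a) (r : Ioo (0 : ℝ) 1) (θ : Torus) :
    F (dilate r θ) = fourierSum (fun n => a n * dilationFactor r n) θ :=
  (h.hasSum_dilate r θ).tsum_eq.symm

theorem lintegral_dilate_le (p : ℝ) (F : Ell1 → ℂ) (r : Ioo (0 : ℝ) 1) :
    ∫⁻ θ, ‖F (dilate r θ)‖ₑ ^ p ∂torusMeasure ≤ hardyIntegral p F :=
  le_iSup (fun r : Ioo (0 : ℝ) 1 => ∫⁻ θ, ‖F (dilate r θ)‖ₑ ^ p ∂torusMeasure) r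

theorem eventually_mem_Ioo : ∀ᶠ r : ℝ in 𝓝[<] 1, r ∈ Ioo (0 : ℝ) 1 :=
  Ioo_mem_nhdsLT one_pos

theorem exists_norm_le_of_mem_hardySeq {p : ℝ} (hp : 1 ≤ p) {a : ℕ+ → ℂ} (ha : a ∈ hardySeq p) :
    ∃ C : ℝ, ∀ n, ‖a n‖ ≤ C := by
  obtain ⟨F, ⟨-, hF⟩, h⟩ := ha
  have hp0 : 0 < p := zero_lt_one.trans_le hp
  refine ⟨(hardyIntegral p F ^ p⁻¹).toReal, fun n => ?_⟩
  have hle : ∀ r : Ioo (0 : ℝ) 1,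
      ‖a n * dilationFactor r n‖ ≤ (hardyIntegral p F ^ p⁻¹).toReal := by
    intro r
    have h1 := (enorm_coeff_rpow_le (h.summable_dilate r) hp n).trans
      ((lintegral_congr fun θ => by rw [h.dilate_eq r θ]).le.trans (lintegral_dilate_le p F r))
    rw [← toReal_enorm]
    refine ENNReal.toReal_mono (ENNReal.rpow_ne_top_of_nonneg (by positivity) hF.ne) ?_
    exact (ENNReal.le_rpow_inv_iff hp0).2 h1
  -- The bound is uniform in r, so it survives r → 1, where the dilation factor tends to 1.
  have hlim : Filter.Tendsto (fun r : ℝ => ‖a n * dilationFactor r n‖) (𝓝[<] 1) (𝓝 ‖a n‖) := by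
    have hc : Continuous fun r : ℝ => ‖a n * dilationFactor r n‖ :=
      (continuous_const.mul
        (Complex.continuous_ofReal.comp (continuous_dilationFactor n))).norm
    simpa [dilationFactor_one] using (hc.tendsto 1).mono_left nhdsWithin_le_nhds
  exact le_of_tendsto hlim (eventually_mem_Ioo.mono fun r hr => hle ⟨r, hr⟩)

theorem summable_sq_of_mem_hardySeq_two {a : ℕ+ → ℂ} (ha : a ∈ hardySeq 2) :
    Summable fun n => ‖a n‖ ^ 2 := by
  obtain ⟨F, ⟨-, hF⟩, h⟩ := ha
  refine summable_of_sum_le (c := (hardyIntegral 2 F).toReal) (fun n => sq_nonneg _) fun T => ?_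
  have hle : ∀ r : Ioo (0 : ℝ) 1,
      ∑ n ∈ T, ‖a n * dilationFactor r n‖ ^ 2 ≤ (hardyIntegral 2 F).toReal := by
    intro r
    have hs := h.summable_dilate r
    refine ((hasSum_sq_coeff hs).summable.sum_le_tsum T fun n _ => sq_nonneg _).trans ?_
    rw [← ENNReal.ofReal_le_iff_le_toReal hF.ne, ← lintegral_sq_fourierSum hs]
    exact (lintegral_congr fun θ => by rw [h.dilate_eq r θ]).le.trans (lintegral_dilate_le 2 F r)
  have hlim : Filter.Tendsto (fun r : ℝ => ∑ n ∈ T, ‖a n * dilationFactor r n‖ ^ 2) (𝓝[<] 1)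
      (𝓝 (∑ n ∈ T, ‖a n‖ ^ 2)) := by
    have hc : Continuous fun r : ℝ => ∑ n ∈ T, ‖a n * dilationFactor r n‖ ^ 2 :=
      continuous_finsetSum _ fun n _ => (continuous_const.mul
        (Complex.continuous_ofReal.comp (continuous_dilationFactor n))).norm.pow 2
    simpa [dilationFactor_one] using (hc.tendsto 1).mono_left nhdsWithin_le_nhds
  exact le_of_tendsto hlim (eventually_mem_Ioo.mono fun r hr => hle ⟨r, hr⟩)

theorem mem_hardySeq_of_summable_sq {p : ℝ} (hp0 : 0 < p) (hp2 : p ≤ 2) {a : ℕ+ → ℂ}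
    (ha : Summable fun n => ‖a n‖ ^ 2) : a ∈ hardySeq p := by
  have h := hasMonomialExpansion_seriesSum ha
  refine ⟨seriesSum a, ⟨isAnalytic_seriesSum ha, ?_⟩, h⟩
  refine lt_of_le_of_lt (iSup_le fun r => ?_ :
    _ ≤ (ENNReal.ofReal (∑' n, ‖a n‖ ^ 2) ^ (1 / 2 : ℝ)) ^ p) ?_
  · have hs := h.summable_dilate r
    simp only [h.dilate_eq r]
    rw [lintegral_rpow_enorm_eq_rpow_eLpNorm' hp0]
    gcongr
    refine (eLpNorm'_le_eLpNorm'_of_exponent_le hp0 hp2 _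
      (continuous_fourierSum hs).aestronglyMeasurable).trans ?_
    rw [eLpNorm'_eq_lintegral_enorm, lintegral_sq_fourierSum hs]
    gcongr ENNReal.ofReal ?_ ^ _
    refine (hasSum_sq_coeff hs).summable.tsum_le_tsum (fun n => ?_) ha
    rw [norm_mul, Complex.norm_of_nonneg (dilationFactor_nonneg r n)]
    have := dilationFactor_nonneg r n
    gcongr
    exact mul_le_of_le_one_right (norm_nonneg (a n)) (dilationFactor_le_one r n)
  · exact ENNReal.rpow_lt_top_of_nonneg hp0.le
      (ENNReal.rpow_ne_top_of_nonneg (by norm_num) ENNReal.ofReal_ne_top)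

/-! ### Multipliers. -/

theorem summable_sq_mul {l a : ℕ+ → ℂ} (hl : l ∈ ellInfty) (ha : Summable fun n => ‖a n‖ ^ 2) :
    Summable fun n => ‖l n * a n‖ ^ 2 := by
  obtain ⟨C, hC⟩ := hl
  refine Summable.of_nonneg_of_le (fun n => sq_nonneg _) (fun n => ?_) (ha.mul_left (C ^ 2))
  rw [norm_mul, mul_pow]
  gcongr
  exact hC n

theorem exists_injective_of_notMem_ellInfty {l : ℕ+ → ℂ} (hl : l ∉ ellInfty) :
    ∃ ν : ℕ → ℕ+, Function.Injective ν ∧ ∀ k, 4 ^ k ≤ ‖l (ν k)‖ := by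
  -- Otherwise a tail of the sequence is bounded, and hence so is the whole sequence.
  have hfreq : ∀ k : ℕ, ∃ᶠ m in Filter.atTop, (4 : ℝ) ^ k ≤ ‖l (Nat.succPNat m)‖ := by
    intro k hk
    have hb : Filter.IsBoundedUnder (· ≤ ·) Filter.atTop fun m => ‖l (Nat.succPNat m)‖ :=
      ⟨4 ^ k, Filter.eventually_map.2 (hk.mono fun m hm => (not_le.1 hm).le)⟩
    obtain ⟨C, hC⟩ := hb.bddAbove_range
    refine hl ⟨C, fun n => ?_⟩
    simpa using hC ⟨PNat.natPred n, rfl⟩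
  obtain ⟨φ, hφ, h⟩ := Filter.extraction_forall_of_frequently hfreq
  exact ⟨fun k => Nat.succPNat (φ k), Nat.succPNat_injective.comp hφ.injective, h⟩

theorem mem_ellInfty_of_mem_multipliers {p : ℝ} (hp : 1 ≤ p) {l : ℕ+ → ℂ}
    (hl : l ∈ multipliers (hardySeq 2) (hardySeq p)) : l ∈ ellInfty := by
  by_contra hunb
  obtain ⟨ν, hν, h4⟩ := exists_injective_of_notMem_ellInfty hunb
  -- The ratio 1/2 is square-summable yet loses to 4^k: the products are at least 2^k in modulus.
  let a : ℕ+ → ℂ := Function.extend ν (fun k => (2⁻¹ : ℂ) ^ k) 0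
  have haν : ∀ k, a (ν k) = 2⁻¹ ^ k := hν.extend_apply _ _
  have ha : Summable fun n => ‖a n‖ ^ 2 := by
    refine (hν.summable_iff fun n hn => ?_).1 ?_
    · simp [a, Function.extend_apply' _ _ _ hn]
    · have : Summable fun k : ℕ => (4⁻¹ : ℝ) ^ k :=
        summable_geometric_of_lt_one (by norm_num) (by norm_num)
      refine this.congr fun k => ?_
      rw [Function.comp_apply, haν, norm_pow, ← pow_mul, mul_comm, pow_mul]
      norm_num
  obtain ⟨C, hC⟩ := exists_norm_le_of_mem_hardySeq hp
    (hl a (mem_hardySeq_of_summable_sq two_pos le_rfl ha))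
  obtain ⟨k, hk⟩ := pow_unbounded_of_one_lt C one_lt_two
  refine (hC (ν k)).not_gt (hk.trans_le ?_)
  calc (2 : ℝ) ^ k = 4 ^ k * 2⁻¹ ^ k := by rw [← mul_pow]; norm_num
    _ ≤ ‖l (ν k)‖ * 2⁻¹ ^ k := by gcongr; exact h4 k
    _ = ‖l (ν k) * a (ν k)‖ := by rw [haν, norm_mul, norm_pow]; norm_num

end InfHardy

end

theorem theorem3p6 (p : ℝ) (hp1 : 1 ≤ p) (hp2 : p ≤ 2) :
    InfHardy.multipliers (InfHardy.hardySeq 2) (InfHardy.hardySeq p) = InfHardy.ellInfty := by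
  refine Set.Subset.antisymm (fun l hl => InfHardy.mem_ellInfty_of_mem_multipliers hp1 hl)
    fun l hl a ha => ?_
  exact InfHardy.mem_hardySeq_of_summable_sq (zero_lt_one.trans_le hp1) hp2
    (InfHardy.summable_sq_mul hl (InfHardy.summable_sq_of_mem_hardySeq_two ha))
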